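/- Identify the Heisenberg group $H_1$ with $\mathbb{R}^3$, with left-invariant vector fields $\mathring e_1=\partial_x+y\,\partial_z$, $\mathring e_2=\partial_y-x\,\partial_z$, $T=\partial_z$, contact form $\Theta=dz+x\,dy-y\,dx$, contact planes $\xi=\ker\Theta$, the complex structure $J\mathring e_1=\mathring e_2$, $J\mathring e_2=-\mathring e_1$ on $\xi$, and the metric for which $\mathring e_1,\mathring e_2,T$ are orthonormal. (Bernstein-type theorem.) A function $u:\mathbb{R}^2\to\mathbb{R}$ is an entire $C^\infty$ solution of the $p$-minimal graph equation $$(u_y+x)^2u_{xx}-2(u_y+x)(u_x-y)u_{xy}+(u_x-y)^2u_{yy}=0\quad\text{on }\mathbb{R}^2$$ if and only if either $$u(x,y)=Ax+By+C\quad\text{for some constants }A,B,C\in\mathbb{R},$$ or $$u(x,y)=-ABx^2+(A^2-B^2)xy+ABy^2+g(-Bx+Ay)$$ for some constants $A,B\in\mathbb{R}$ with $A^2+B^2=1$ and some $g\in C^\infty(\mathbb{R})$. Moreover, let $u$ be such an entire solution and $\Sigma=\{z=u(x,y)\}$ its graph. A point of $\Sigma$ is regular if the tangent plane of $\Sigma$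 there differs from $\xi$. Then there is no curve of regular points of $\Sigma$, defined on a nonempty open interval, whose velocity $e_1$ is a unit vector in $\xi$ and along which the function $\alpha$, determined by the condition that $\alpha Je_1+T$ is tangent to $\Sigma$, has the form $$\alpha(s)=\frac{s+c_1}{(s+c_1)^2+c_2}$$ in the parameter $s$ of the curve, with constants $c_1$ and $c_2\neq 0$ (that is, no characteristic curve of $\Sigma$ along which $\alpha$ is of general type). -/

import Mathlib

open scoped ContDiff

noncomputable section

namespace PMinimal

/-- The partial derivative `∂u/∂x` of a function of `(x, y)`. -/
def dx (u : ℝ × ℝ → ℝ) (p : ℝ × ℝ) : ℝ := deriv (fun t => u (t, p.2)) p.1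

/-- The partial derivative `∂u/∂y` of a function of `(x, y)`. -/
def dy (u : ℝ × ℝ → ℝ) (p : ℝ × ℝ) : ℝ := deriv (fun t => u (p.1, t)) p.2

/-- The `p`-minimal graph equation
`(u_y + x)² u_xx - 2 (u_y + x) (u_x - y) u_xy + (u_x - y)² u_yy = 0` at the point `p = (x, y)`. -/
def GraphEquationAt (u : ℝ × ℝ → ℝ) (p : ℝ × ℝ) : Prop :=
  (dy u p + p.1) ^ 2 * dx (dx u) p
    - 2 * (dy u p + p.1) * (dx u p - p.2) * dy (dx u) p
    + (dx u p - p.2) ^ 2 * dy (dy u) p = 0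

/-- Entire smooth solutions of the `p`-minimal graph equation. -/
def IsEntireSmoothSolution (u : ℝ × ℝ → ℝ) : Prop :=
  ContDiff ℝ ∞ u ∧ ∀ p : ℝ × ℝ, GraphEquationAt u p

/-- The family `u = A x + B y + C`. -/
def IsAffineSolution (u : ℝ × ℝ → ℝ) : Prop :=
  ∃ A B C : ℝ, ∀ x y : ℝ, u (x, y) = A * x + B * y + C

/-- The family `u = -A B x² + (A² - B²) x y + A B y² + g (-B x + A y)`, `A² + B² = 1`,
`g` smooth on the real line. -/
def IsRuledSolution (u : ℝ × ℝ → ℝ) : Prop :=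
  ∃ A B : ℝ, A ^ 2 + B ^ 2 = 1 ∧ ∃ g : ℝ → ℝ, ContDiff ℝ ∞ g ∧
    ∀ x y : ℝ, u (x, y) =
      -(A * B) * x ^ 2 + (A ^ 2 - B ^ 2) * x * y + A * B * y ^ 2 + g (-B * x + A * y)

/-! Points of the Heisenberg group `H₁`, and tangent vectors at a point, are triples
`(x, y, z)`, the latter with respect to `∂/∂x, ∂/∂y, ∂/∂z`. -/

/-- The contact form `Θ = dz + x dy - y dx` at the point `q`. -/
def contactForm (q v : ℝ × ℝ × ℝ) : ℝ := v.2.2 + q.1 * v.2.1 - q.2.1 * v.1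

/-- The contact vector `a e̊₁ + b e̊₂` at `q`, where `e̊₁ = ∂/∂x + y ∂/∂z`,
`e̊₂ = ∂/∂y - x ∂/∂z`. In the adapted metric its squared length is `a² + b²`, and
`J (a e̊₁ + b e̊₂) = -b e̊₁ + a e̊₂`. -/
def horizontal (a b : ℝ) (q : ℝ × ℝ × ℝ) : ℝ × ℝ × ℝ :=
  a • ((1, 0, q.2.1) : ℝ × ℝ × ℝ) + b • ((0, 1, -q.1) : ℝ × ℝ × ℝ)

/-- The vector field `T = ∂/∂z`. -/
def reeb : ℝ × ℝ × ℝ := (0, 0, 1)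

/-- The point of the graph of `u` over `p`. -/
def graphPoint (u : ℝ × ℝ → ℝ) (p : ℝ × ℝ) : ℝ × ℝ × ℝ := (p.1, p.2, u p)

/-- `v` is tangent to the graph of `u` at the point over `p`. -/
def TangentToGraph (u : ℝ × ℝ → ℝ) (p : ℝ × ℝ) (v : ℝ × ℝ × ℝ) : Prop :=
  v.2.2 = dx u p * v.1 + dy u p * v.2.1

/-- Over `p` the tangent plane of the graph differs from the contact plane. -/
def IsRegularPoint (u : ℝ × ℝ → ℝ) (p : ℝ × ℝ) : Prop :=
  ¬ ∀ v : ℝ × ℝ × ℝ, TangentToGraph u p v ↔ contactForm (graphPoint u p) v = 0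

/-- The graph of `u` contains a piece of a characteristic curve along which `α` is of general
type: a curve `s ↦ graphPoint u (c s)`, `s₀ < s < s₁`, of regular points, with velocity
`e₁ = a e̊₁ + b e̊₂` of unit length (so that `s` is the first coordinate of a compatible coordinate
system), along which the function `α`, determined by `α e₂ + T` being tangent to the graph with
`e₂ = J e₁`, is `(s + c₁) / ((s + c₁)² + c₂)` for constants `c₁` and `c₂ ≠ 0`. -/
def HasGeneralTypeLeaf (u : ℝ × ℝ → ℝ) : Prop :=
  ∃ (s₀ s₁ : ℝ) (c : ℝ → ℝ × ℝ) (a b α : ℝ → ℝ) (c₁ c₂ : ℝ), s₀ < s₁ ∧ c₂ ≠ 0 ∧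
    ∀ s ∈ Set.Ioo s₀ s₁,
      IsRegularPoint u (c s) ∧
      a s ^ 2 + b s ^ 2 = 1 ∧
      HasDerivAt (fun t => graphPoint u (c t)) (horizontal (a s) (b s) (graphPoint u (c s))) s ∧
      TangentToGraph u (c s) (α s • horizontal (-b s) (a s) (graphPoint u (c s)) + reeb) ∧
      (s + c₁) ^ 2 + c₂ ≠ 0 ∧
      α s = (s + c₁) / ((s + c₁) ^ 2 + c₂)

end PMinimal

end

/-! Write `S = (u_x - y, u_y + x)`. A point is regular when `S ≠ 0`; there pick a unit `(a, b)`
orthogonal to `S`, and put `D = S · (-b, a)` (`transverse`) and `v = Hess u((a, b), (-b, a))`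
(`hessMixed`). The equation makes characteristic curves straight lines, with `Hess u((a, b), (a, b))
= 0` and hence `det Hess u = -v²` on them. One more normal derivative gives the closed system `D' =
1 + v`, `D v' = 2v(v - 1)`. Unless `v = 1`, it integrates to `(1 - v)(t + σ) = D`, `(t + σ)² v = K`.

Follow the line towards the focal parameter `t = -σ`. Continuity of `v` there forces `K = 0`, unless
the line first meets a singular point, which needs `0 < v < 1` initially. So `v ∈ [0, 1]` at every
regular point, and by density `det Hess u ≥ -1` everywhere. In the exceptional case `det Hess u =
-K²/(t + σ)⁴` reaches this minimum `-1` at the singular point with nonzero one-sided slope, which is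
impossible for a smooth function. Thus `v ∈ {0, 1}` (`hessMixed_eq_zero_or_one`), and by
connectedness `det Hess u` is constantly `0` or `-1`.

If it is `0`, the map to focal points `p ↦ (-u_y, u_x)` is idempotent, which kills the Hessian: `u`
is affine. If it is `-1`, the direction of `S` is constant, which gives the ruled family. A leaf of
general type would have `v = -c₂/(s + c₁)²`, which is neither `0` nor `1`. -/

noncomputable section

namespace PMinimal

open Set

/-! ### Partial derivatives -/

section Calculus

variable {G : ℝ × ℝ → ℝ}

lemma hasDerivAt_comp_curve (hG : Differentiable ℝ G) {c : ℝ → ℝ × ℝ} {a b s : ℝ}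
    (hc : HasDerivAt c (a, b) s) :
    HasDerivAt (fun t => G (c t))
      (a * fderiv ℝ G (c s) (1, 0) + b * fderiv ℝ G (c s) (0, 1)) s := by
  have h := (hG (c s)).hasFDerivAt.comp_hasDerivAt s hc
  have e : ((a, b) : ℝ × ℝ) = a • (1, 0) + b • (0, 1) := by ext <;> simp
  rw [e, map_add, map_smul, map_smul] at h
  exact h

lemma dx_eq_fderiv (hG : Differentiable ℝ G) (p : ℝ × ℝ) : dx G p = fderiv ℝ G p (1, 0) := by
  have hc : HasDerivAt (fun t : ℝ => (t, p.2)) ((1 : ℝ), (0 : ℝ)) p.1 :=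
    (hasDerivAt_id p.1).prodMk (hasDerivAt_const p.1 p.2)
  simpa [dx] using (hasDerivAt_comp_curve hG hc).deriv

lemma dy_eq_fderiv (hG : Differentiable ℝ G) (p : ℝ × ℝ) : dy G p = fderiv ℝ G p (0, 1) := by
  have hc : HasDerivAt (fun t : ℝ => (p.1, t)) ((0 : ℝ), (1 : ℝ)) p.2 :=
    (hasDerivAt_const p.2 p.1).prodMk (hasDerivAt_id p.2)
  simpa [dy] using (hasDerivAt_comp_curve hG hc).deriv

/-- The chain rule along a plane curve. -/
lemma hasDerivAt_along (hG : ContDiff ℝ ∞ G) {c : ℝ → ℝ × ℝ} {a b s : ℝ}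
    (hc : HasDerivAt c (a, b) s) :
    HasDerivAt (fun t => G (c t)) (a * dx G (c s) + b * dy G (c s)) s := by
  have hd := hG.differentiable (by simp)
  rw [dx_eq_fderiv hd, dy_eq_fderiv hd]
  exact hasDerivAt_comp_curve hd hc

lemma contDiff_dx (hG : ContDiff ℝ ∞ G) : ContDiff ℝ ∞ (dx G) := by
  have : dx G = fun p => fderiv ℝ G p (1, 0) :=
    funext (dx_eq_fderiv (hG.differentiable (by simp)))
  rw [this]
  exact (hG.fderiv_right (m := ∞) (by simp)).clm_apply contDiff_const

lemma contDiff_dy (hG : ContDiff ℝ ∞ G) : ContDiff ℝ ∞ (dy G) := by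
  have : dy G = fun p => fderiv ℝ G p (0, 1) :=
    funext (dy_eq_fderiv (hG.differentiable (by simp)))
  rw [this]
  exact (hG.fderiv_right (m := ∞) (by simp)).clm_apply contDiff_const

/-- Symmetry of mixed partial derivatives. -/
lemma dx_dy_comm (hG : ContDiff ℝ ∞ G) : dx (dy G) = dy (dx G) := by
  funext p
  have hd := hG.differentiable (by simp)
  have h' : Differentiable ℝ (fderiv ℝ G) :=
    (hG.fderiv_right (m := ∞) (by simp)).differentiable (by simp)
  rw [dx_eq_fderiv ((contDiff_dy hG).differentiable (by simp)),
    dy_eq_fderiv ((contDiff_dx hG).differentiable (by simp)),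
    funext (dx_eq_fderiv hd), funext (dy_eq_fderiv hd)]
  have hs : IsSymmSndFDerivAt ℝ G p := hG.contDiffAt.isSymmSndFDerivAt
    (by simpa using WithTop.coe_le_coe.2 (le_top (a := (2 : ℕ∞))))
  rw [fderiv_clm_apply (h' p) (by fun_prop), fderiv_clm_apply (h' p) (by fun_prop)]
  simpa using hs (1, 0) (0, 1)

/-- The straight line through `p` with direction `(a, b)`. -/
def line (p : ℝ × ℝ) (a b t : ℝ) : ℝ × ℝ := (p.1 + t * a, p.2 + t * b)

lemma hasDerivAt_line (p : ℝ × ℝ) (a b t : ℝ) : HasDerivAt (line p a b) (a, b) t := by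
  have h (c d : ℝ) : HasDerivAt (fun t : ℝ => c + t * d) d t := by
    simpa using ((hasDerivAt_id t).mul_const d).const_add c
  exact (h p.1 a).prodMk (h p.2 b)

lemma line_zero (p : ℝ × ℝ) (a b : ℝ) : line p a b 0 = p := by simp [line]

lemma fderiv_eq_zero_iff (hG : ContDiff ℝ ∞ G) (p : ℝ × ℝ) :
    fderiv ℝ G p = 0 ↔ dx G p = 0 ∧ dy G p = 0 := by
  have hd := hG.differentiable (by simp)
  rw [dx_eq_fderiv hd, dy_eq_fderiv hd]
  constructor
  · intro h; simp [h]
  · rintro ⟨h₁, h₂⟩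
    ext <;> simp [h₁, h₂]

lemma eq_of_dx_dy_eq_zero (hG : ContDiff ℝ ∞ G) (h₁ : ∀ p, dx G p = 0) (h₂ : ∀ p, dy G p = 0)
    (p q : ℝ × ℝ) : G p = G q :=
  is_const_of_fderiv_eq_zero (𝕜 := ℝ) (hG.differentiable (by simp))
    (fun p => (fderiv_eq_zero_iff hG p).2 ⟨h₁ p, h₂ p⟩) p q

end Calculus

/-! ### Ordinary differential equations -/

/-- A solution of a homogeneous linear equation which vanishes initially stays zero. -/
lemma eq_zero_of_linear_ode {f f' m : ℝ → ℝ} {T : ℝ} (hf : ∀ t, HasDerivAt f (f' t) t)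
    (hm : ContinuousOn m (Ico 0 T)) (h : ∀ t ∈ Ico 0 T, f' t = m t * f t) (h0 : f 0 = 0) :
    ∀ t ∈ Ico 0 T, f t = 0 := by
  intro t ht
  have hsub : Icc 0 t ⊆ Ico 0 T := fun x hx => ⟨hx.1, hx.2.trans_lt ht.2⟩
  obtain ⟨C, hC⟩ := isCompact_Icc.exists_bound_of_continuousOn (hm.mono hsub)
  refine eq_zero_of_abs_deriv_le_mul_abs_self_of_eq_zero_right (K := C) (f' := f') (a := 0) (b := t)
    (fun x _ => (hf x).continuousAt.continuousWithinAt) (fun x _ => (hf x).hasDerivWithinAt) h0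
    (fun x hx => ?_) t ⟨ht.1, le_rfl⟩
  have hxt := Ico_subset_Icc_self hx
  rw [h x (hsub hxt), norm_mul]
  gcongr
  exact hC x hxt

/-- Integration of the system `D' = 1 + v`, `D v' = 2 v (v - 1)`. -/
lemma first_integrals {D v v' : ℝ → ℝ} {T σ : ℝ} (hD : ∀ t, HasDerivAt D (1 + v t) t)
    (hv : ∀ t, HasDerivAt v (v' t) t) (hne : ∀ t ∈ Ico 0 T, D t ≠ 0)
    (h : ∀ t ∈ Ico 0 T, D t * v' t = 2 * v t * (v t - 1)) (hσ : (1 - v 0) * σ = D 0) :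
    ∀ t ∈ Ico 0 T, (1 - v t) * (t + σ) = D t ∧ (t + σ) ^ 2 * v t = σ ^ 2 * v 0 := by
  have hlin (t : ℝ) : HasDerivAt (fun t => t + σ) 1 t := (hasDerivAt_id t).add_const σ
  have hDc : Continuous D := continuous_iff_continuousAt.2 fun t => (hD t).continuousAt
  have hvc : Continuous v := continuous_iff_continuousAt.2 fun t => (hv t).continuousAt
  have key : ∀ t ∈ Ico 0 T, (1 - v t) * (t + σ) - D t = 0 := by
    refine eq_zero_of_linear_ode (f := fun t => (1 - v t) * (t + σ) - D t)
      (m := fun t => 2 * v t / D t)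
      (fun t => ((((hv t).const_sub 1).mul (hlin t)).sub (hD t)))
      (((continuous_const.mul hvc).continuousOn).div hDc.continuousOn hne) ?_ (by simp [hσ])
    intro t ht
    have h1 := hne t ht
    have h2 := h t ht
    field_simp
    linear_combination (-(t + σ)) * h2
  have key2 : ∀ t ∈ Ico 0 T, (t + σ) ^ 2 * v t - σ ^ 2 * v 0 = 0 := by
    refine eq_zero_of_linear_ode (f := fun t => (t + σ) ^ 2 * v t - σ ^ 2 * v 0)
      (m := fun _ => 0)
      (fun t => ((((hlin t).fun_pow 2).mul (hv t)).sub_const _)) continuousOn_const ?_ (by simp)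
    intro t ht
    have h1 := hne t ht
    have h2 := h t ht
    have h3 := key t ht
    apply mul_left_cancel₀ h1
    push_cast
    linear_combination (t + σ) ^ 2 * h2 - 2 * (t + σ) * v t * h3
  exact fun t ht => ⟨by linarith [key t ht], by linarith [key2 t ht]⟩

lemma eq_at_right_endpoint {f g : ℝ → ℝ} {T : ℝ} (hT : 0 < T) (hf : Continuous f)
    (hg : Continuous g) (h : ∀ t ∈ Ico 0 T, f t = g t) : f T = g T := by
  have : EqOn f g (closure (Ico 0 T)) := EqOn.closure h hf hg
  exact this (by rw [closure_Ico hT.ne]; exact ⟨hT.le, le_rfl⟩)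

/-- If the first zero of `D` is necessarily a zero of `g`, and `g` has no zeros, then neither
does `D`. -/
lemma ne_zero_of_first_zero {D g : ℝ → ℝ} {T : ℝ} (hD : Continuous D) (h0 : D 0 ≠ 0)
    (hg : ∀ t ∈ Ico 0 T, g t ≠ 0)
    (h : ∀ τ, 0 < τ → (∀ t ∈ Ico 0 τ, D t ≠ 0) → D τ = 0 → g τ = 0) :
    ∀ t ∈ Ico 0 T, D t ≠ 0 := by
  intro t ht hDt
  have hcomp : IsCompact (Icc 0 t ∩ D ⁻¹' {0}) :=
    isCompact_Icc.inter_right (isClosed_singleton.preimage hD)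
  obtain ⟨τ, ⟨hτ, hDτ⟩, hmin⟩ := hcomp.exists_isLeast ⟨t, ⟨ht.1, le_rfl⟩, hDt⟩
  have hτ0 : 0 < τ := lt_of_le_of_ne hτ.1 (fun e => h0 (e ▸ hDτ))
  refine hg τ ⟨hτ.1, hτ.2.trans_lt ht.2⟩ (h τ hτ0 (fun x hx hx0 => ?_) hDτ)
  exact absurd (hmin ⟨⟨hx.1, hx.2.le.trans hτ.2⟩, hx0⟩) (not_le.2 hx.2)

/-! ### The slope vector and the Hessian in rotated frames -/

/-- `u_x - y`. -/
def slopeX (u : ℝ × ℝ → ℝ) (p : ℝ × ℝ) : ℝ := dx u p - p.2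

/-- `u_y + x`. -/
def slopeY (u : ℝ × ℝ → ℝ) (p : ℝ × ℝ) : ℝ := dy u p + p.1

/-- The component of `(u_x - y, u_y + x)` along `(a, b)`. -/
def tangential (u : ℝ × ℝ → ℝ) (a b : ℝ) (p : ℝ × ℝ) : ℝ := a * slopeX u p + b * slopeY u p

/-- The component of `(u_x - y, u_y + x)` along `(-b, a)`. -/
def transverse (u : ℝ × ℝ → ℝ) (a b : ℝ) (p : ℝ × ℝ) : ℝ := a * slopeY u p - b * slopeX u p

/-- The value of the Hessian form of `u` on the pair `(a, b), (a, b)`. -/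
def hessDiag (u : ℝ × ℝ → ℝ) (a b : ℝ) (p : ℝ × ℝ) : ℝ :=
  a ^ 2 * dx (dx u) p + 2 * a * b * dy (dx u) p + b ^ 2 * dy (dy u) p

/-- The value of the Hessian form of `u` on the pair `(a, b), (-b, a)`. -/
def hessMixed (u : ℝ × ℝ → ℝ) (a b : ℝ) (p : ℝ × ℝ) : ℝ :=
  a * b * (dy (dy u) p - dx (dx u) p) + (a ^ 2 - b ^ 2) * dy (dx u) p

/-- The Hessian determinant of `u`. -/
def hessDet (u : ℝ × ℝ → ℝ) (p : ℝ × ℝ) : ℝ :=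
  dx (dx u) p * dy (dy u) p - dy (dx u) p ^ 2

section Smooth

variable {u : ℝ × ℝ → ℝ} {c : ℝ → ℝ × ℝ} {k l s : ℝ}

lemma contDiff_slopeX (hu : ContDiff ℝ ∞ u) : ContDiff ℝ ∞ (slopeX u) :=
  (contDiff_dx hu).sub contDiff_snd

lemma contDiff_slopeY (hu : ContDiff ℝ ∞ u) : ContDiff ℝ ∞ (slopeY u) :=
  (contDiff_dy hu).add contDiff_fst

lemma contDiff_tangential (hu : ContDiff ℝ ∞ u) (a b : ℝ) : ContDiff ℝ ∞ (tangential u a b) :=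
  (contDiff_const.mul (contDiff_slopeX hu)).add (contDiff_const.mul (contDiff_slopeY hu))

lemma contDiff_transverse (hu : ContDiff ℝ ∞ u) (a b : ℝ) : ContDiff ℝ ∞ (transverse u a b) :=
  (contDiff_const.mul (contDiff_slopeY hu)).sub (contDiff_const.mul (contDiff_slopeX hu))

lemma contDiff_hessMixed (hu : ContDiff ℝ ∞ u) (a b : ℝ) : ContDiff ℝ ∞ (hessMixed u a b) :=
  (contDiff_const.mul ((contDiff_dy (contDiff_dy hu)).sub (contDiff_dx (contDiff_dx hu)))).add
    (contDiff_const.mul (contDiff_dy (contDiff_dx hu)))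

lemma contDiff_hessDiag (hu : ContDiff ℝ ∞ u) (a b : ℝ) : ContDiff ℝ ∞ (hessDiag u a b) :=
  ((contDiff_const.mul (contDiff_dx (contDiff_dx hu))).add
    (contDiff_const.mul (contDiff_dy (contDiff_dx hu)))).add
    (contDiff_const.mul (contDiff_dy (contDiff_dy hu)))

lemma contDiff_hessDet (hu : ContDiff ℝ ∞ u) : ContDiff ℝ ∞ (hessDet u) :=
  ((contDiff_dx (contDiff_dx hu)).mul (contDiff_dy (contDiff_dy hu))).sub
    ((contDiff_dy (contDiff_dx hu)).pow 2)

lemma hasDerivAt_slopeX (hu : ContDiff ℝ ∞ u) (hc : HasDerivAt c (k, l) s) :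
    HasDerivAt (fun t => slopeX u (c t)) (k * dx (dx u) (c s) + l * (dy (dx u) (c s) - 1)) s := by
  have h := (hasDerivAt_along (contDiff_dx hu) hc).sub
    ((hasFDerivAt_snd (𝕜 := ℝ)).comp_hasDerivAt s hc)
  exact h.congr_deriv (by simp; ring)

lemma hasDerivAt_slopeY (hu : ContDiff ℝ ∞ u) (hc : HasDerivAt c (k, l) s) :
    HasDerivAt (fun t => slopeY u (c t)) (k * (dy (dx u) (c s) + 1) + l * dy (dy u) (c s)) s := by
  have h := (hasDerivAt_along (contDiff_dy hu) hc).add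
    ((hasFDerivAt_fst (𝕜 := ℝ)).comp_hasDerivAt s hc)
  rw [dx_dy_comm hu] at h
  exact h.congr_deriv (by simp; ring)

lemma hasDerivAt_tangential (hu : ContDiff ℝ ∞ u) (hc : HasDerivAt c (k, l) s) (a b : ℝ) :
    HasDerivAt (fun t => tangential u a b (c t))
      (a * (k * dx (dx u) (c s) + l * (dy (dx u) (c s) - 1))
        + b * (k * (dy (dx u) (c s) + 1) + l * dy (dy u) (c s))) s :=
  ((hasDerivAt_slopeX hu hc).const_mul a).add ((hasDerivAt_slopeY hu hc).const_mul b)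

lemma hasDerivAt_transverse (hu : ContDiff ℝ ∞ u) (hc : HasDerivAt c (k, l) s) (a b : ℝ) :
    HasDerivAt (fun t => transverse u a b (c t))
      (a * (k * (dy (dx u) (c s) + 1) + l * dy (dy u) (c s))
        - b * (k * dx (dx u) (c s) + l * (dy (dx u) (c s) - 1))) s :=
  ((hasDerivAt_slopeY hu hc).const_mul a).sub ((hasDerivAt_slopeX hu hc).const_mul b)

end Smooth

lemma hessDet_eq {a b : ℝ} (hab : a ^ 2 + b ^ 2 = 1) (u : ℝ × ℝ → ℝ) (p : ℝ × ℝ) :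
    hessDet u p = hessDiag u a b p * hessDiag u (-b) a p - hessMixed u a b p ^ 2 := by
  have h : (a ^ 2 + b ^ 2) ^ 2 = 1 := by rw [hab, one_pow]
  unfold hessDet hessDiag hessMixed
  linear_combination (dx (dx u) p * dy (dy u) p - dy (dx u) p ^ 2) * (-h)

/-- The `p`-minimal graph equation in a rotated frame. -/
lemma graphEquationAt_frame {u : ℝ × ℝ → ℝ} {p : ℝ × ℝ} (h : GraphEquationAt u p) (a b : ℝ) :
    transverse u a b p ^ 2 * hessDiag u a b p
      - 2 * transverse u a b p * tangential u a b p * hessMixed u a b p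
      + tangential u a b p ^ 2 * hessDiag u (-b) a p = 0 := by
  have e : slopeY u p ^ 2 * dx (dx u) p - 2 * slopeY u p * slopeX u p * dy (dx u) p
      + slopeX u p ^ 2 * dy (dy u) p = 0 := h
  unfold transverse tangential hessDiag hessMixed
  linear_combination (a ^ 2 + b ^ 2) ^ 2 * e

/-! ### The system along a characteristic line -/

section Lines

variable {u : ℝ × ℝ → ℝ} {a b : ℝ}

lemma hasDerivAt_transverse_line (hu : ContDiff ℝ ∞ u) (hab : a ^ 2 + b ^ 2 = 1) (p : ℝ × ℝ)
    (t : ℝ) : HasDerivAt (fun t => transverse u a b (line p a b t))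
      (1 + hessMixed u a b (line p a b t)) t := by
  refine (hasDerivAt_transverse hu (hasDerivAt_line p a b t) a b).congr_deriv ?_
  unfold hessMixed
  linear_combination hab

lemma hasDerivAt_tangential_line (hu : ContDiff ℝ ∞ u) (p : ℝ × ℝ) (t : ℝ) :
    HasDerivAt (fun t => tangential u a b (line p a b t)) (hessDiag u a b (line p a b t)) t := by
  refine (hasDerivAt_tangential hu (hasDerivAt_line p a b t) a b).congr_deriv ?_
  unfold hessDiag
  ring

/-- Along a straight line which starts in a characteristic direction the direction stays
characteristic as long as the points are regular. -/
lemma tangential_eq_zero_of_line (hu : IsEntireSmoothSolution u)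
    {p : ℝ × ℝ} (hp : tangential u a b p = 0) {T : ℝ}
    (hT : ∀ t ∈ Ico 0 T, transverse u a b (line p a b t) ≠ 0) :
    ∀ t ∈ Ico 0 T, tangential u a b (line p a b t) = 0 := by
  have hl : Continuous (line p a b) :=
    continuous_iff_continuousAt.2 fun t => (hasDerivAt_line p a b t).continuousAt
  have c1 := (contDiff_transverse hu.1 a b).continuous.comp hl
  have c2 := (contDiff_tangential hu.1 a b).continuous.comp hl
  have c3 := (contDiff_hessMixed hu.1 a b).continuous.comp hl
  have c4 := (contDiff_hessDiag hu.1 (-b) a).continuous.comp hl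
  refine eq_zero_of_linear_ode (f := fun t => tangential u a b (line p a b t))
    (m := fun t => (2 * transverse u a b (line p a b t) * hessMixed u a b (line p a b t)
      - tangential u a b (line p a b t) * hessDiag u (-b) a (line p a b t))
      / transverse u a b (line p a b t) ^ 2)
    (fun t => hasDerivAt_tangential_line hu.1 p t) ?_ ?_ (by simpa [line_zero] using hp)
  · exact ContinuousOn.div (((continuous_const.mul c1).mul c3).sub (c2.mul c4)).continuousOn
      (c1.pow 2).continuousOn (fun t ht => pow_ne_zero 2 (hT t ht))
  · intro t ht
    have h := graphEquationAt_frame (hu.2 (line p a b t)) a b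
    have h1 := hT t ht
    field_simp
    linear_combination h

lemma hessDiag_eq_zero (hu : IsEntireSmoothSolution u)
    {p : ℝ × ℝ} (hp : tangential u a b p = 0) (hp' : transverse u a b p ≠ 0) :
    hessDiag u a b p = 0 := by
  have h := graphEquationAt_frame (hu.2 p) a b
  rw [hp] at h
  have : transverse u a b p ^ 2 * hessDiag u a b p = 0 := by linear_combination h
  exact (mul_eq_zero.1 this).resolve_left (pow_ne_zero 2 hp')

lemma hasDerivAt_hessMixed (hu : ContDiff ℝ ∞ u) (p : ℝ × ℝ) (t : ℝ) :
    HasDerivAt (fun t => hessMixed u a b (line p a b t))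
      (a * dx (hessMixed u a b) (line p a b t) + b * dy (hessMixed u a b) (line p a b t)) t :=
  hasDerivAt_along (contDiff_hessMixed hu a b) (hasDerivAt_line p a b t)

/-- The Codazzi type identity between the third derivatives of `u`. -/
lemma deriv_hessDiag_normal (hu : ContDiff ℝ ∞ u) (p : ℝ × ℝ) :
    -b * dx (hessDiag u a b) p + a * dy (hessDiag u a b) p
      = a * dx (hessMixed u a b) p + b * dy (hessMixed u a b) p := by
  have hr := contDiff_dx (contDiff_dx hu)
  have hs := contDiff_dy (contDiff_dx hu)
  have ht := contDiff_dy (contDiff_dy hu)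
  have e1 : dx (dy (dx u)) = dy (dx (dx u)) := dx_dy_comm (contDiff_dx hu)
  have e2 : dx (dy (dy u)) = dy (dy (dx u)) := by rw [dx_dy_comm (contDiff_dy hu), dx_dy_comm hu]
  have h (k l : ℝ) (h' : HasDerivAt (line p k l) (k, l) 0) :=
    (hasDerivAt_along (contDiff_hessDiag hu a b) h').unique
    ((((hasDerivAt_along hr h').const_mul (a ^ 2)).add
      ((hasDerivAt_along hs h').const_mul (2 * a * b))).add
      ((hasDerivAt_along ht h').const_mul (b ^ 2)))
  have g (k l : ℝ) (h' : HasDerivAt (line p k l) (k, l) 0) :=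
    (hasDerivAt_along (contDiff_hessMixed hu a b) h').unique
    ((((hasDerivAt_along ht h').sub (hasDerivAt_along hr h')).const_mul (a * b)).add
      ((hasDerivAt_along hs h').const_mul (a ^ 2 - b ^ 2)))
  have h1 := h (-b) a (hasDerivAt_line _ _ _ _)
  have h2 := g a b (hasDerivAt_line _ _ _ _)
  simp only [line_zero, e1, e2] at h1 h2
  rw [h1, h2]
  ring

/-- The second equation of the system satisfied along a characteristic line. -/
lemma transverse_mul_deriv_hessMixed (hu : IsEntireSmoothSolution u) (hab : a ^ 2 + b ^ 2 = 1)
    {p : ℝ × ℝ} (hp : tangential u a b p = 0) (hp' : transverse u a b p ≠ 0) :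
    transverse u a b p * (a * dx (hessMixed u a b) p + b * dy (hessMixed u a b) p)
      = 2 * hessMixed u a b p * (hessMixed u a b p - 1) := by
  have hl := hasDerivAt_line p (-b) a 0
  have hw := hessDiag_eq_zero hu hp hp'
  have hD := hasDerivAt_transverse hu.1 hl a b
  have hf := hasDerivAt_tangential hu.1 hl a b
  have hw' := hasDerivAt_along (contDiff_hessDiag hu.1 a b) hl
  have hv := hasDerivAt_along (contDiff_hessMixed hu.1 a b) hl
  have hh := hasDerivAt_along (contDiff_hessDiag hu.1 (-b) a) hl
  -- Differentiate the framed equation in the normal direction. Since the tangential component and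
  -- `hessDiag` vanish at `p`, only `D² ∂ₙ hessDiag - 2 D v ∂ₙ tangential` survives, with `∂ₙ
  -- tangential = v - 1`.
  have hE := (((hD.fun_pow 2).mul hw').sub (((hD.const_mul 2).mul hf).mul hv)).add
    ((hf.fun_pow 2).mul hh)
  have h0 := hE.unique ((hasDerivAt_const (0 : ℝ) (0 : ℝ)).congr_of_eventuallyEq
    (Filter.Eventually.of_forall fun t => graphEquationAt_frame (hu.2 (line p (-b) a t)) a b))
  simp only [line_zero, hp, hw, deriv_hessDiag_normal hu.1] at h0
  have hf2 : a * (-b * dx (dx u) p + a * (dy (dx u) p - 1))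
      + b * (-b * (dy (dx u) p + 1) + a * dy (dy u) p) = hessMixed u a b p - 1 := by
    unfold hessMixed
    linear_combination -hab
  rw [hf2] at h0
  apply mul_left_cancel₀ hp'
  norm_num [line_zero, hp] at h0
  linear_combination h0

end Lines

/-! ### Focal points and the range of `v` -/

/-- The possible behaviours of a solution of `D' = 1 + v`, `D v' = 2 v (v - 1)` towards the
focal parameter `-σ`, when `D` is continuous there. -/
lemma focal_dichotomy {D v v' : ℝ → ℝ} {σ : ℝ} (hD : ∀ t, HasDerivAt D (1 + v t) t)
    (hv : ∀ t, HasDerivAt v (v' t) t)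
    (h : ∀ T, (∀ t ∈ Ico 0 T, D t ≠ 0) → ∀ t ∈ Ico 0 T, D t * v' t = 2 * v t * (v t - 1))
    (h0 : D 0 ≠ 0) (hσ : (1 - v 0) * σ = D 0) (hneg : σ < 0) :
    (v 0 = 0 ∧ (∀ t ∈ Ico 0 (-σ), D t ≠ 0) ∧ D (-σ) = 0) ∨
    (0 < v 0 ∧ v 0 < 1 ∧ ∃ K T, 0 < T ∧ T + σ < 0 ∧ (T + σ) ^ 2 = K ∧
      (∀ t ∈ Ico 0 T, D t ≠ 0) ∧ ∀ t ∈ Ico 0 T, (t + σ) ^ 2 * v t = K) := by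
  have hDc : Continuous D := continuous_iff_continuousAt.2 fun t => (hD t).continuousAt
  have hvc : Continuous v := continuous_iff_continuousAt.2 fun t => (hv t).continuousAt
  have hend : ∀ τ, 0 < τ → (∀ t ∈ Ico 0 τ, D t ≠ 0) →
      (1 - v τ) * (τ + σ) = D τ ∧ (τ + σ) ^ 2 * v τ = σ ^ 2 * v 0 := by
    intro τ hτ hne
    have hi := first_integrals hD hv hne (h τ hne) hσ
    exact ⟨eq_at_right_endpoint (f := fun t => (1 - v t) * (t + σ)) hτ (by fun_prop) hDc
        (fun t ht => (hi t ht).1),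
      eq_at_right_endpoint (f := fun t => (t + σ) ^ 2 * v t) (g := fun _ => σ ^ 2 * v 0) hτ
        (by fun_prop) continuous_const (fun t ht => (hi t ht).2)⟩
  set K := σ ^ 2 * v 0 with hK
  -- The two integrals combine to `(t + σ) D = (t + σ)² - K`, so `D` cannot vanish before the
  -- right-hand side does.
  have hcont : ∀ T, (∀ t ∈ Ico 0 T, (t + σ) ^ 2 - K ≠ 0) → ∀ t ∈ Ico 0 T, D t ≠ 0 := by
    intro T hT
    refine ne_zero_of_first_zero (g := fun t => (t + σ) ^ 2 - K) hDc h0 hT ?_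
    intro τ hτ hne hDτ
    obtain ⟨h1, h2⟩ := hend τ hτ hne
    rw [hDτ] at h1
    linear_combination (τ + σ) * h1 + h2
  have hσK : D 0 * σ = σ ^ 2 - K := by rw [hK]; linear_combination -σ * hσ
  have hne0 : σ ^ 2 - K ≠ 0 := hσK ▸ mul_ne_zero h0 hneg.ne
  have hσ2 : 0 < σ ^ 2 := by nlinarith
  rcases eq_or_ne K 0 with h1 | h1
  · left
    have hv0 : v 0 = 0 := (mul_eq_zero.1 h1).resolve_left hσ2.ne'
    have hD' := hcont (-σ) (fun t ht => by
      rw [h1, sub_zero]; exact pow_ne_zero 2 (by linarith [ht.2]))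
    refine ⟨hv0, hD', ?_⟩
    have := (hend (-σ) (by linarith) hD').1
    simpa using this.symm
  -- If `D` had no zero before `-σ`, then `(t + σ)² v = K` would persist up to `-σ` and give `K =
  -- 0`. This excludes `K < 0` and `K > σ²`; the value `K = σ²` would mean `D 0 = 0`.
  · have hbad : ¬ ∀ t ∈ Ico 0 (-σ), (t + σ) ^ 2 - K ≠ 0 := fun hh =>
      h1 (by simpa using ((hend (-σ) (by linarith) (hcont _ hh)).2).symm)
    have hKpos : 0 < K := by
      by_contra hK0
      exact hbad fun t _ => by
        have : K < 0 := lt_of_le_of_ne (not_lt.1 hK0) h1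
        nlinarith [sq_nonneg (t + σ)]
    have hKlt : K < σ ^ 2 := by
      by_contra hK1
      refine hbad fun t ht => ?_
      have h3 : σ ^ 2 < K := lt_of_le_of_ne (not_lt.1 hK1) (fun e => hne0 (by rw [← e]; ring))
      have : (t + σ) ^ 2 ≤ σ ^ 2 := by nlinarith [ht.1, ht.2]
      linarith
    right
    have hs := Real.sqrt_pos.2 hKpos
    have hs2 := Real.sq_sqrt hKpos.le
    have hlt : Real.sqrt K < -σ := by
      rw [Real.sqrt_lt' (by linarith)]; linarith [neg_sq σ]
    have hD' := hcont (-σ - Real.sqrt K) (fun t ht => by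
      have := ht.2
      have : (t + σ) ^ 2 > Real.sqrt K ^ 2 := by nlinarith
      rw [hs2] at this
      linarith)
    refine ⟨by_contra fun hc => ?_, by_contra fun hc => ?_, K, -σ - Real.sqrt K, by linarith,
      by linarith, by linear_combination hs2, hD',
      fun t ht => (first_integrals hD hv hD' (h _ hD') hσ t ht).2⟩
    · nlinarith
    · nlinarith

section

variable {u : ℝ × ℝ → ℝ} {a b : ℝ} {p : ℝ × ℝ}

lemma slope_eq_zero (hab : a ^ 2 + b ^ 2 = 1) (h₁ : tangential u a b p = 0)
    (h₂ : transverse u a b p = 0) : slopeX u p = 0 ∧ slopeY u p = 0 := by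
  unfold tangential at h₁
  unfold transverse at h₂
  constructor
  · linear_combination a * h₁ - b * h₂ - slopeX u p * hab
  · linear_combination b * h₁ + a * h₂ - slopeY u p * hab

lemma continuous_line (p : ℝ × ℝ) (a b : ℝ) : Continuous (line p a b) :=
  continuous_iff_continuousAt.2 fun t => (hasDerivAt_line p a b t).continuousAt

/-- A characteristic line traced towards its focal point meets a singular point. -/
lemma characteristic_dichotomy (hu : IsEntireSmoothSolution u) (hab : a ^ 2 + b ^ 2 = 1)
    (hp : tangential u a b p = 0) (hp' : transverse u a b p ≠ 0) {σ : ℝ}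
    (hσ : (1 - hessMixed u a b p) * σ = transverse u a b p) (hneg : σ < 0) :
    (hessMixed u a b p = 0 ∧ slopeX u (line p a b (-σ)) = 0 ∧ slopeY u (line p a b (-σ)) = 0) ∨
    (0 < hessMixed u a b p ∧ hessMixed u a b p < 1 ∧ ∃ K T, 0 < T ∧ T + σ < 0 ∧ (T + σ) ^ 2 = K ∧
      ∀ t ∈ Ico 0 T, (t + σ) ^ 4 * hessDet u (line p a b t) = -K ^ 2) := by
  have hf := fun (T : ℝ) (hT : ∀ t ∈ Ico 0 T, transverse u a b (line p a b t) ≠ 0) =>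
    tangential_eq_zero_of_line hu hp hT
  have key := focal_dichotomy (fun t => hasDerivAt_transverse_line hu.1 hab p t)
    (fun t => hasDerivAt_hessMixed hu.1 p t)
    (fun T hT t ht => transverse_mul_deriv_hessMixed hu hab (hf T hT t ht) (hT t ht))
    (by simpa [line_zero] using hp') (by simpa [line_zero] using hσ) hneg
  simp only [line_zero] at key
  rcases key with ⟨h1, h2, h3⟩ | ⟨h1, h2, K, T, h3, h4, h5, h6, h7⟩
  · refine Or.inl ⟨h1, slope_eq_zero hab ?_ h3⟩
    exact eq_at_right_endpoint (f := fun t => tangential u a b (line p a b t)) (g := fun _ => 0)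
      (by linarith)
      ((contDiff_tangential hu.1 a b).continuous.comp (continuous_line p a b)) continuous_const
      (hf _ h2)
  · refine Or.inr ⟨h1, h2, K, T, h3, h4, h5, fun t ht => ?_⟩
    rw [hessDet_eq hab, hessDiag_eq_zero hu (hf T h6 t ht) (h6 t ht), ← h7 t ht]
    ring

/-- Reversing the line flips `D` but not `v`, so the sign of `σ` can be chosen. -/
lemma characteristic_reverse : tangential u (-a) (-b) p = -tangential u a b p ∧
    transverse u (-a) (-b) p = -transverse u a b p ∧
    hessMixed u (-a) (-b) p = hessMixed u a b p := by
  refine ⟨?_, ?_, ?_⟩ <;> simp only [tangential, transverse, hessMixed] <;> ring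

/-- At a regular point the mixed Hessian value is `1`, or else one of the two characteristic
directions points towards the focal point. -/
lemma exists_focal_direction (hab : a ^ 2 + b ^ 2 = 1) (hp : tangential u a b p = 0)
    (hp' : transverse u a b p ≠ 0) (hv : hessMixed u a b p ≠ 1) :
    ∃ a' b' σ : ℝ, a' ^ 2 + b' ^ 2 = 1 ∧ tangential u a' b' p = 0 ∧ transverse u a' b' p ≠ 0 ∧
      hessMixed u a' b' p = hessMixed u a b p ∧
      (1 - hessMixed u a' b' p) * σ = transverse u a' b' p ∧ σ < 0 := by
  have hv' : 1 - hessMixed u a b p ≠ 0 := sub_ne_zero.2 hv.symm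
  obtain ⟨r1, r2, r3⟩ := characteristic_reverse (u := u) (a := a) (b := b) (p := p)
  rcases lt_or_gt_of_ne (div_ne_zero hp' hv') with h | h
  · exact ⟨a, b, _, hab, hp, hp', rfl, mul_div_cancel₀ _ hv', h⟩
  · refine ⟨-a, -b, -(transverse u a b p / (1 - hessMixed u a b p)), by simpa using hab,
      by rw [r1, hp, neg_zero], by rw [r2]; exact neg_ne_zero.2 hp', r3, ?_, by linarith⟩
    rw [r3, r2, mul_neg, mul_div_cancel₀ _ hv']

/-- Outside this range the characteristic line would reach its focal point with `K ≠ 0`. -/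
lemma hessMixed_mem_Icc (hu : IsEntireSmoothSolution u) (hab : a ^ 2 + b ^ 2 = 1)
    (hp : tangential u a b p = 0) (hp' : transverse u a b p ≠ 0) :
    hessMixed u a b p ∈ Icc (0 : ℝ) 1 := by
  by_cases hv : hessMixed u a b p = 1
  · simp [hv]
  · obtain ⟨a', b', σ, h1, h2, h3, h4, h5, h6⟩ := exists_focal_direction hab hp hp' hv
    rw [← h4]
    rcases characteristic_dichotomy hu h1 h2 h3 h5 h6 with h | h
    · simp [h.1]
    · exact ⟨h.1.le, h.2.1.le⟩

/-- At a point where `(u_x - y, u_y + x) ≠ 0` there is a unit characteristic direction. -/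
lemma exists_characteristic_direction (h : ¬ (slopeX u p = 0 ∧ slopeY u p = 0)) :
    ∃ a b : ℝ, a ^ 2 + b ^ 2 = 1 ∧ tangential u a b p = 0 ∧ transverse u a b p ≠ 0 ∧
      slopeX u p = -b * transverse u a b p ∧ slopeY u p = a * transverse u a b p := by
  have hpos : 0 < slopeX u p ^ 2 + slopeY u p ^ 2 := by
    by_contra hc
    exact h ⟨by nlinarith [sq_nonneg (slopeX u p), sq_nonneg (slopeY u p)],
      by nlinarith [sq_nonneg (slopeX u p), sq_nonneg (slopeY u p)]⟩
  set N := Real.sqrt (slopeX u p ^ 2 + slopeY u p ^ 2) with hN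
  have hN0 : N ≠ 0 := (Real.sqrt_pos.2 hpos).ne'
  have hN2 : N ^ 2 = slopeX u p ^ 2 + slopeY u p ^ 2 := Real.sq_sqrt hpos.le
  have hD : transverse u (slopeY u p / N) (-slopeX u p / N) p = N := by
    unfold transverse
    field_simp
    linear_combination -hN2
  refine ⟨slopeY u p / N, -slopeX u p / N, ?_, ?_, ?_, ?_, ?_⟩
  · field_simp
    linear_combination -hN2
  · unfold tangential
    field_simp
    ring
  · rwa [hD]
  · rw [hD]; field_simp
  · rw [hD]; field_simp

/-! ### The Hessian determinant is constant -/

/-- Regular points are dense. -/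
lemma dense_regular (hu : ContDiff ℝ ∞ u) : Dense {p | ¬ (slopeX u p = 0 ∧ slopeY u p = 0)} := by
  intro p
  by_contra hc
  rw [mem_closure_iff_frequently, Filter.not_frequently] at hc
  have hX : slopeX u =ᶠ[nhds p] fun _ => 0 := hc.mono fun q hq => (not_not.1 hq).1
  have hY : slopeY u =ᶠ[nhds p] fun _ => 0 := hc.mono fun q hq => (not_not.1 hq).2
  -- On an open set of singular points `u_xy = 1` from the first slope and `u_xy = -1` from the
  -- second.
  have h1 := (hasDerivAt_slopeX hu (hasDerivAt_line p 0 1 0)).unique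
    ((hasDerivAt_const (0 : ℝ) (0 : ℝ)).congr_of_eventuallyEq
      (((continuous_line p 0 1).tendsto' 0 p (line_zero _ _ _)).eventually hX))
  have h2 := (hasDerivAt_slopeY hu (hasDerivAt_line p 1 0 0)).unique
    ((hasDerivAt_const (0 : ℝ) (0 : ℝ)).congr_of_eventuallyEq
      (((continuous_line p 1 0).tendsto' 0 p (line_zero _ _ _)).eventually hY))
  simp only [line_zero] at h1 h2
  linarith

/-- At regular points the determinant is `-v²` with `v ∈ [0, 1]`; density does the rest. -/
lemma neg_one_le_hessDet (hu : IsEntireSmoothSolution u) (p : ℝ × ℝ) : -1 ≤ hessDet u p := by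
  have hcl : IsClosed {p | -1 ≤ hessDet u p} :=
    isClosed_le continuous_const (contDiff_hessDet hu.1).continuous
  refine (closure_minimal (fun q hq => ?_) hcl) (dense_regular hu.1 p)
  obtain ⟨a, b, hab, h1, h2, -⟩ := exists_characteristic_direction hq
  obtain ⟨h3, h4⟩ := hessMixed_mem_Icc hu hab h1 h2
  rw [mem_ofPred_eq, hessDet_eq hab, hessDiag_eq_zero hu h1 h2]
  nlinarith

/-- Only the two special types of characteristic lines occur in entire solutions. -/
lemma hessMixed_eq_zero_or_one (hu : IsEntireSmoothSolution u) (hab : a ^ 2 + b ^ 2 = 1)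
    (hp : tangential u a b p = 0) (hp' : transverse u a b p ≠ 0) :
    hessMixed u a b p = 0 ∨ hessMixed u a b p = 1 := by
  by_cases hv : hessMixed u a b p = 1
  · exact Or.inr hv
  left
  obtain ⟨a', b', σ, h1, h2, h3, h4, h5, h6⟩ := exists_focal_direction hab hp hp' hv
  rw [← h4]
  rcases characteristic_dichotomy hu h1 h2 h3 h5 h6 with h | ⟨-, -, K, T, hT, hTσ, hK, hdet⟩
  · exact h.1
  exfalso
  have hder := hasDerivAt_along (contDiff_hessDet hu.1) (hasDerivAt_line p a' b' T)
  have hK0 : K ≠ 0 := hK ▸ pow_ne_zero 2 hTσ.ne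
  have hcont : Continuous fun t => hessDet u (line p a' b' t) :=
    (contDiff_hessDet hu.1).continuous.comp (continuous_line p a' b')
  have hdetT : (T + σ) ^ 4 * hessDet u (line p a' b' T) = -K ^ 2 :=
    eq_at_right_endpoint (f := fun t => (t + σ) ^ 4 * hessDet u (line p a' b' t))
      (g := fun _ => -K ^ 2) hT (by fun_prop) continuous_const hdet
  have hval : hessDet u (line p a' b' T) = -1 := by
    apply mul_left_cancel₀ (pow_ne_zero 4 hTσ.ne)
    rw [hdetT, ← hK]
    ring
  have hmin : IsLocalMin (fun t => hessDet u (line p a' b' t)) T :=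
    Filter.Eventually.of_forall fun t => by
      simpa only [hval] using neg_one_le_hessDet hu (line p a' b' t)
  rw [hmin.hasDerivAt_eq_zero hder] at hder
  have hlin : HasDerivAt (fun t : ℝ => t + σ) 1 T := (hasDerivAt_id T).add_const σ
  -- With zero derivative of the determinant at its minimum, `(t + σ)⁴ det` has derivative `-4(T +
  -- σ)³ ≠ 0` at `T`; yet it is constant to the left of `T`.
  have hprod := ((hlin.fun_pow 4).mul hder).hasDerivWithinAt (s := Iic T)
  have hconst : HasDerivWithinAt
      ((fun t => (t + σ) ^ 4) * fun t => hessDet u (line p a' b' t)) 0 (Iic T) T := by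
    refine (hasDerivWithinAt_const T (Iic T) (-K ^ 2)).congr_of_eventuallyEq ?_ hdetT
    filter_upwards [Icc_mem_nhdsLE hT] with t ht
    rcases ht.2.eq_or_lt with e | hlt
    · rw [e]; exact hdetT
    · exact hdet t ⟨ht.1, hlt⟩
  have := (uniqueDiffWithinAt_Iic T).eq_deriv _ hprod hconst
  rw [hval] at this
  norm_num at this
  exact hTσ.ne this

lemma hessDet_eq_zero_or_neg_one (hu : IsEntireSmoothSolution u) (p : ℝ × ℝ) :
    hessDet u p = 0 ∨ hessDet u p = -1 := by
  have hc := (contDiff_hessDet hu.1).continuous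
  have hcl : IsClosed {p | hessDet u p = 0 ∨ hessDet u p = -1} :=
    (isClosed_eq hc continuous_const).union (isClosed_eq hc continuous_const)
  refine (closure_minimal (fun q hq => ?_) hcl) (dense_regular hu.1 p)
  obtain ⟨a, b, hab, h1, h2, -⟩ := exists_characteristic_direction hq
  rw [mem_ofPred_eq, hessDet_eq hab, hessDiag_eq_zero hu h1 h2]
  rcases hessMixed_eq_zero_or_one hu hab h1 h2 with h | h <;> simp [h]

lemma hessDet_const (hu : IsEntireSmoothSolution u) :
    (∀ p, hessDet u p = 0) ∨ ∀ p, hessDet u p = -1 := by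
  by_contra hc
  push Not at hc
  obtain ⟨⟨p, hp⟩, q, hq⟩ := hc
  have hp' := (hessDet_eq_zero_or_neg_one hu p).resolve_left hp
  have hq' := (hessDet_eq_zero_or_neg_one hu q).resolve_right hq
  obtain ⟨z, hz⟩ := mem_range_of_exists_le_of_exists_ge (contDiff_hessDet hu.1).continuous
    ⟨p, (show hessDet u p ≤ -1 / 2 by rw [hp']; norm_num)⟩
    ⟨q, (show -1 / 2 ≤ hessDet u q by rw [hq']; norm_num)⟩
  rcases hessDet_eq_zero_or_neg_one hu z with h | h <;> rw [h] at hz <;> norm_num at hz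

end

variable {u : ℝ × ℝ → ℝ}

/-! ### Vanishing Hessian determinant -/

/-- If the Hessian determinant vanishes, the focal point `(-u_y, u_x)` of the characteristic line
through a point is singular. -/
lemma singular_focal_point (hu : IsEntireSmoothSolution u) (h : ∀ p, hessDet u p = 0)
    (p : ℝ × ℝ) :
    dx u (-dy u p, dx u p) = dx u p ∧ dy u (-dy u p, dx u p) = dy u p := by
  by_cases hp : slopeX u p = 0 ∧ slopeY u p = 0
  · have h1 : dx u p = p.2 := sub_eq_zero.1 hp.1
    have h2 : -dy u p = p.1 := by have := hp.2; unfold slopeY at this; linarith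
    rw [h2, h1, Prod.mk.eta]
    exact ⟨h1, rfl⟩
  · obtain ⟨a, b, hab, ht, hD, -⟩ := exists_characteristic_direction hp
    have hv : hessMixed u a b p = 0 := by
      have := h p
      rw [hessDet_eq hab, hessDiag_eq_zero hu ht hD] at this
      simpa using this
    obtain ⟨a, b, σ, hab, ht, hD, hv', hσ, hneg⟩ :=
      exists_focal_direction hab ht hD (by rw [hv]; norm_num)
    have hv0 := hv'.trans hv
    have hs : slopeX u (line p a b (-σ)) = 0 ∧ slopeY u (line p a b (-σ)) = 0 := by
      rcases characteristic_dichotomy hu hab ht hD hσ hneg with h' | h'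
      · exact h'.2
      · exact absurd h'.1 (by rw [hv0]; exact lt_irrefl _)
    -- For `v = 0` one has `σ = D`, and `D (a, b) = (u_y + x, y - u_x)`.
    have hl : line p a b (-σ) = (-dy u p, dx u p) := by
      have hσ' : σ = a * slopeY u p - b * slopeX u p := by
        rw [hv0, sub_zero, one_mul] at hσ
        exact hσ
      have ht' : a * slopeX u p + b * slopeY u p = 0 := ht
      unfold slopeX slopeY at hσ' ht'
      ext
      · change p.1 + -σ * a = -dy u p
        rw [hσ']
        linear_combination -(dy u p + p.1) * hab + b * ht'
      · change p.2 + -σ * b = dx u p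
        rw [hσ']
        linear_combination (dx u p - p.2) * hab - a * ht'
    rw [hl] at hs
    obtain ⟨h1, h2⟩ := hs
    unfold slopeX at h1
    unfold slopeY at h2
    exact ⟨by simpa using sub_eq_zero.1 h1, by simp only at h2; linarith⟩

/-- The map `F = (-u_y, u_x)` satisfies `F ∘ F = F`. At a fixed point `dF` is idempotent, while its
square is `-det Hess u = 0` because it is traceless; so `dF = 0` there. Elsewhere `dF(p) = dF(F p)
dF(p) = 0`. -/
lemma hess_eq_zero (hu : IsEntireSmoothSolution u) (h : ∀ p, hessDet u p = 0) (p : ℝ × ℝ) :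
    dx (dx u) p = 0 ∧ dy (dx u) p = 0 ∧ dy (dy u) p = 0 := by
  have hux := contDiff_dx hu.1
  have huy := contDiff_dy hu.1
  have hder (p : ℝ × ℝ) (k l : ℝ) :
      -(k * dy (dx u) p + l * dy (dy u) p) * dx (dx u) (-dy u p, dx u p)
        + (k * dx (dx u) p + l * dy (dx u) p) * dy (dx u) (-dy u p, dx u p)
        = k * dx (dx u) p + l * dy (dx u) p ∧
      -(k * dy (dx u) p + l * dy (dy u) p) * dy (dx u) (-dy u p, dx u p)
        + (k * dx (dx u) p + l * dy (dx u) p) * dy (dy u) (-dy u p, dx u p)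
        = k * dy (dx u) p + l * dy (dy u) p := by
    have hl := hasDerivAt_line p k l 0
    have h1 := hasDerivAt_along hux hl
    have h2 := hasDerivAt_along huy hl
    have hc := h2.neg.prodMk h1
    have e1 := (hasDerivAt_along hux hc).unique (h1.congr_of_eventuallyEq
      (Filter.Eventually.of_forall fun t => (singular_focal_point hu h (line p k l t)).1))
    have e2 := (hasDerivAt_along huy hc).unique (h2.congr_of_eventuallyEq
      (Filter.Eventually.of_forall fun t => (singular_focal_point hu h (line p k l t)).2))
    simp only [Pi.neg_apply, line_zero, dx_dy_comm hu.1] at e1 e2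
    exact ⟨e1, e2⟩
  have hfix (p : ℝ × ℝ) (hp1 : -dy u p = p.1) (hp2 : dx u p = p.2) :
      dx (dx u) p = 0 ∧ dy (dx u) p = 0 ∧ dy (dy u) p = 0 := by
    have h1 := hder p 1 0
    have h2 := hder p 0 1
    have h3 := h p
    rw [hp1, hp2, Prod.mk.eta] at h1 h2
    unfold hessDet at h3
    refine ⟨?_, ?_, ?_⟩
    · linear_combination -h1.1
    · linear_combination -h1.2 + h3
    · linear_combination -h2.2
  obtain ⟨f1, f2⟩ := singular_focal_point hu h p
  obtain ⟨g1, g2, g3⟩ := hfix (-dy u p, dx u p) (by rw [f2]) f1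
  have h1 := hder p 1 0
  have h2 := hder p 0 1
  rw [g1, g2, g3] at h1 h2
  exact ⟨by linarith [h1.1], by linarith [h1.2], by linarith [h2.2]⟩

lemma isAffineSolution_of_hessDet (hu : IsEntireSmoothSolution u) (h : ∀ p, hessDet u p = 0) :
    IsAffineSolution u := by
  have hx := eq_of_dx_dy_eq_zero (contDiff_dx hu.1) (fun p => (hess_eq_zero hu h p).1)
    (fun p => (hess_eq_zero hu h p).2.1)
  have hy := eq_of_dx_dy_eq_zero (contDiff_dy hu.1)
    (fun p => by rw [dx_dy_comm hu.1]; exact (hess_eq_zero hu h p).2.1)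
    (fun p => (hess_eq_zero hu h p).2.2)
  refine ⟨dx u 0, dy u 0, u 0, fun x y => ?_⟩
  have hd (t : ℝ) : HasDerivAt (fun t => u (line 0 x y t) - t * (x * dx u 0 + y * dy u 0)) 0 t := by
    refine ((hasDerivAt_along hu.1 (hasDerivAt_line 0 x y t)).sub
      ((hasDerivAt_id t).mul_const _)).congr_deriv ?_
    rw [hx (line 0 x y t) 0, hy (line 0 x y t) 0]
    ring
  have := is_const_of_deriv_eq_zero (fun t => (hd t).differentiableAt) (fun t => (hd t).deriv) 1 0
  simp only [line_zero] at this
  simp only [line, Prod.fst_zero, Prod.snd_zero, one_mul, zero_add, zero_mul, sub_zero] at this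
  linarith

/-! ### Hessian determinant `-1` -/

/-- Both partial derivatives of `S` are parallel to `S`: their components along `(a, b)` are
governed by `hessDiag = 0` and `v - 1 = 0`. -/
lemma slope_proportional (hu : IsEntireSmoothSolution u) (h : ∀ p, hessDet u p = -1)
    (p : ℝ × ℝ) :
    slopeY u p * dx (dx u) p = slopeX u p * (dy (dx u) p + 1) ∧
    slopeY u p * (dy (dx u) p - 1) = slopeX u p * dy (dy u) p := by
  by_cases hp : slopeX u p = 0 ∧ slopeY u p = 0
  · simp [hp.1, hp.2]
  · obtain ⟨a, b, hab, ht, hD, e1, e2⟩ := exists_characteristic_direction hp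
    have hw := hessDiag_eq_zero hu ht hD
    have hv : hessMixed u a b p = 1 := by
      rcases hessMixed_eq_zero_or_one hu hab ht hD with h' | h'
      · have := h p
        rw [hessDet_eq hab, hw, h'] at this
        norm_num at this
      · exact h'
    rw [e1, e2]
    unfold hessDiag at hw
    unfold hessMixed at hv
    constructor
    · linear_combination transverse u a b p * (a * hw - b * hv
        - (a * dx (dx u) p + b * dy (dx u) p) * hab)
    · linear_combination transverse u a b p * (b * hw + a * hv
        - (a * dy (dx u) p + b * dy (dy u) p) * hab)

lemma dx_tangential (hu : ContDiff ℝ ∞ u) (a b : ℝ) (p : ℝ × ℝ) :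
    dx (tangential u a b) p = a * dx (dx u) p + b * (dy (dx u) p + 1) := by
  have hl := hasDerivAt_line p 1 0 0
  have := (hasDerivAt_along (contDiff_tangential hu a b) hl).unique
    (hasDerivAt_tangential hu hl a b)
  simp only [line_zero] at this
  linear_combination this

lemma dy_tangential (hu : ContDiff ℝ ∞ u) (a b : ℝ) (p : ℝ × ℝ) :
    dy (tangential u a b) p = a * (dy (dx u) p - 1) + b * dy (dy u) p := by
  have hl := hasDerivAt_line p 0 1 0
  have := (hasDerivAt_along (contDiff_tangential hu a b) hl).unique
    (hasDerivAt_tangential hu hl a b)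
  simp only [line_zero] at this
  linear_combination this

/-- The square of the cosine of the angle between `(a, b)` and the image of the differential of
`(u_x - y, u_y + x)`, for solutions with Hessian determinant `-1`. -/
def angleSq (u : ℝ × ℝ → ℝ) (a b : ℝ) (p : ℝ × ℝ) : ℝ :=
  (dx (tangential u a b) p ^ 2 + dy (tangential u a b) p ^ 2)
    / ((dx (dx u) p + dy (dy u) p) ^ 2 + 4)

/-- The denominator is at least `4`, so the quotient is smooth also across singular points, where
the direction of `S` is undefined. -/
lemma contDiff_angleSq (hu : ContDiff ℝ ∞ u) (a b : ℝ) : ContDiff ℝ ∞ (angleSq u a b) := by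
  have hf := contDiff_tangential hu a b
  exact (((contDiff_dx hf).pow 2).add ((contDiff_dy hf).pow 2)).div
    ((((contDiff_dx (contDiff_dx hu)).add (contDiff_dy (contDiff_dy hu))).pow 2).add
      contDiff_const) (fun p => by positivity)

/-- At a regular point `dS = S ⊗ ℓ` for a covector `ℓ`, so numerator and denominator are `((a, b) ·
S)² |ℓ|²` and `|S|² |ℓ|²`. -/
lemma angleSq_mul (hu : IsEntireSmoothSolution u) (h : ∀ p, hessDet u p = -1) (a b : ℝ)
    (p : ℝ × ℝ) :
    angleSq u a b p * (slopeX u p ^ 2 + slopeY u p ^ 2) = tangential u a b p ^ 2 := by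
  obtain ⟨h1, h2⟩ := slope_proportional hu h p
  have h3 := h p
  have hM : (dx (dx u) p + dy (dy u) p) ^ 2 + 4 ≠ 0 := by positivity
  unfold hessDet at h3
  -- This is the squared norm of `dS`, rewritten using determinant `-1`.
  have hM' : (dx (dx u) p + dy (dy u) p) ^ 2 + 4 = dx (dx u) p ^ 2 + (dy (dx u) p + 1) ^ 2
      + (dy (dx u) p - 1) ^ 2 + dy (dy u) p ^ 2 := by linear_combination 2 * h3
  have k1 : dx (tangential u a b) p * slopeX u p = dx (dx u) p * tangential u a b p := by
    rw [dx_tangential hu.1]; unfold tangential; linear_combination -b * h1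
  have k2 : dx (tangential u a b) p * slopeY u p = (dy (dx u) p + 1) * tangential u a b p := by
    rw [dx_tangential hu.1]; unfold tangential; linear_combination a * h1
  have k3 : dy (tangential u a b) p * slopeX u p = (dy (dx u) p - 1) * tangential u a b p := by
    rw [dy_tangential hu.1]; unfold tangential; linear_combination -b * h2
  have k4 : dy (tangential u a b) p * slopeY u p = dy (dy u) p * tangential u a b p := by
    rw [dy_tangential hu.1]; unfold tangential; linear_combination a * h2
  rw [angleSq, div_mul_eq_mul_div, div_eq_iff hM, hM']
  have s1 := congrArg (· ^ 2) k1
  have s2 := congrArg (· ^ 2) k2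
  have s3 := congrArg (· ^ 2) k3
  have s4 := congrArg (· ^ 2) k4
  linear_combination s1 + s2 + s3 + s4

/-- At regular points `S` varies only parallel to itself, so its angle with `(a, b)` is stationary;
density extends this. -/
lemma fderiv_angleSq (hu : IsEntireSmoothSolution u) (h : ∀ p, hessDet u p = -1) (a b : ℝ)
    (p : ℝ × ℝ) : fderiv ℝ (angleSq u a b) p = 0 := by
  have hψ := contDiff_angleSq hu.1 a b
  have hcl : IsClosed {p | fderiv ℝ (angleSq u a b) p = 0} :=
    isClosed_eq (hψ.continuous_fderiv (by simp)) continuous_const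
  refine (closure_minimal (fun q hq => ?_) hcl) (dense_regular hu.1 p)
  have hN : slopeX u q ^ 2 + slopeY u q ^ 2 ≠ 0 := fun e =>
    hq ⟨by nlinarith [sq_nonneg (slopeX u q), sq_nonneg (slopeY u q)],
      by nlinarith [sq_nonneg (slopeX u q), sq_nonneg (slopeY u q)]⟩
  have hdir (k l : ℝ) : k * dx (angleSq u a b) q + l * dy (angleSq u a b) q = 0 := by
    have hl := hasDerivAt_line q k l 0
    have hX := hasDerivAt_slopeX hu.1 hl
    have hY := hasDerivAt_slopeY hu.1 hl
    have e := ((hasDerivAt_along hψ hl).mul ((hX.fun_pow 2).add (hY.fun_pow 2))).unique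
      (((hasDerivAt_tangential hu.1 hl a b).fun_pow 2).congr_of_eventuallyEq
        (Filter.Eventually.of_forall fun t => angleSq_mul hu h a b (line q k l t)))
    norm_num [line_zero] at e
    have e0 := angleSq_mul hu h a b q
    obtain ⟨h1, h2⟩ := slope_proportional hu h q
    apply mul_right_cancel₀ (pow_ne_zero 2 hN)
    rw [zero_mul]
    unfold tangential at e e0
    linear_combination (slopeX u q ^ 2 + slopeY u q ^ 2) * e
      - 2 * (slopeX u q * (k * dx (dx u) q + l * (dy (dx u) q - 1))
        + slopeY u q * (k * (dy (dx u) q + 1) + l * dy (dy u) q)) * e0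
      + 2 * (a * slopeX u q + b * slopeY u q) * (a * slopeY u q - b * slopeX u q)
        * (k * h1 + l * h2)
  exact (fderiv_eq_zero_iff hψ q).2 ⟨by simpa using hdir 1 0, by simpa using hdir 0 1⟩

/-- For solutions with Hessian determinant `-1` all characteristic lines are parallel. -/
lemma exists_parallel_direction (hu : IsEntireSmoothSolution u) (h : ∀ p, hessDet u p = -1) :
    ∃ a b : ℝ, a ^ 2 + b ^ 2 = 1 ∧ ∀ p, tangential u a b p = 0 := by
  obtain ⟨p₀, hp₀⟩ := (dense_regular hu.1).nonempty
  obtain ⟨a, b, hab, ht, hD, -⟩ := exists_characteristic_direction hp₀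
  refine ⟨a, b, hab, ?_⟩
  have hN : slopeX u p₀ ^ 2 + slopeY u p₀ ^ 2 ≠ 0 := fun e =>
    hp₀ ⟨by nlinarith [sq_nonneg (slopeX u p₀), sq_nonneg (slopeY u p₀)],
      by nlinarith [sq_nonneg (slopeX u p₀), sq_nonneg (slopeY u p₀)]⟩
  have h0 : angleSq u a b p₀ = 0 := by
    have := angleSq_mul hu h a b p₀
    rw [ht, zero_pow two_ne_zero] at this
    exact (mul_eq_zero.1 this).resolve_right hN
  have hall (p : ℝ × ℝ) : angleSq u a b p = 0 := by
    rw [← h0]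
    exact is_const_of_fderiv_eq_zero (𝕜 := ℝ) ((contDiff_angleSq hu.1 a b).differentiable (by simp))
      (fderiv_angleSq hu h a b) p p₀
  intro p
  have := angleSq_mul hu h a b p
  rw [hall p, zero_mul] at this
  exact pow_eq_zero_iff two_ne_zero |>.1 this.symm

/-- On the line `-b x + a y = τ` the derivative of `u` along `(a, b)` is `a y - b x = τ`, so `u = (a
x + b y) τ + g τ`, where `g` is the restriction of `u` to the perpendicular line through the origin.
-/
lemma isRuledSolution_of_hessDet (hu : IsEntireSmoothSolution u) (h : ∀ p, hessDet u p = -1) :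
    IsRuledSolution u := by
  obtain ⟨a, b, hab, ht⟩ := exists_parallel_direction hu h
  refine ⟨a, b, hab, fun τ => u (-b * τ, a * τ), ?_, fun x y => ?_⟩
  · exact hu.1.comp ((contDiff_const.mul contDiff_id).prodMk (contDiff_const.mul contDiff_id))
  set τ := -b * x + a * y with hτ
  have hd (t : ℝ) : HasDerivAt (fun t => u (line (-b * τ, a * τ) a b t) - t * τ) 0 t := by
    refine ((hasDerivAt_along hu.1 (hasDerivAt_line _ a b t)).sub
      ((hasDerivAt_id t).mul_const _)).congr_deriv ?_
    have := ht (line (-b * τ, a * τ) a b t)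
    simp only [tangential, slopeX, slopeY] at this
    simp only [line] at this ⊢
    linear_combination this + τ * hab
  have := is_const_of_deriv_eq_zero (fun t => (hd t).differentiableAt) (fun t => (hd t).deriv)
    (a * x + b * y) 0
  have hl : line (-b * τ, a * τ) a b (a * x + b * y) = (x, y) := by
    ext <;> simp only [line, hτ]
    · linear_combination x * hab
    · linear_combination y * hab
  simp only [hl, line_zero] at this
  rw [hτ] at this ⊢
  linear_combination this

/-! ### The converse -/

lemma isEntireSmoothSolution_of_affine (h : IsAffineSolution u) : IsEntireSmoothSolution u := by
  obtain ⟨A, B, C, h⟩ := h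
  have e : u = fun p => A * p.1 + B * p.2 + C := funext fun p => h p.1 p.2
  have hx : dx u = fun _ => A := by
    funext p
    simp only [dx, e]
    simp
  have hy : dy u = fun _ => B := by
    funext p
    simp only [dy, e]
    simp
  refine ⟨by rw [e]; fun_prop, fun p => ?_⟩
  unfold GraphEquationAt
  rw [hx, hy]
  simp [dx, dy]

lemma isEntireSmoothSolution_of_ruled (h : IsRuledSolution u) : IsEntireSmoothSolution u := by
  obtain ⟨A, B, hAB, g, hg, h⟩ := h
  have e : u = fun p => -(A * B) * p.1 ^ 2 + (A ^ 2 - B ^ 2) * p.1 * p.2 + A * B * p.2 ^ 2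
      + g (-B * p.1 + A * p.2) := funext fun p => h p.1 p.2
  have hg' : ContDiff ℝ ∞ (deriv g) := (contDiff_infty_iff_deriv.1 hg).2
  have chx {k : ℝ → ℝ} (hk : ContDiff ℝ ∞ k) (p : ℝ × ℝ) :
      HasDerivAt (fun x => k (-B * x + A * p.2)) (deriv k (-B * p.1 + A * p.2) * -B) p.1 :=
    HasDerivAt.comp p.1 (h₂ := k) ((hk.differentiable (by simp)) _).hasDerivAt
      (by simpa using ((hasDerivAt_id p.1).const_mul (-B)).add_const (A * p.2))
  have chy {k : ℝ → ℝ} (hk : ContDiff ℝ ∞ k) (p : ℝ × ℝ) :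
      HasDerivAt (fun y => k (-B * p.1 + A * y)) (deriv k (-B * p.1 + A * p.2) * A) p.2 :=
    HasDerivAt.comp p.2 (h₂ := k) ((hk.differentiable (by simp)) _).hasDerivAt
      (by simpa using ((hasDerivAt_id p.2).const_mul A).const_add (-B * p.1))
  have hx : dx u = fun p => -(A * B) * (2 * p.1) + (A ^ 2 - B ^ 2) * p.2
      - B * deriv g (-B * p.1 + A * p.2) := by
    funext p
    simp only [dx, e]
    refine (((((hasDerivAt_pow 2 p.1).const_mul (-(A * B))).add
      (((hasDerivAt_id p.1).const_mul (A ^ 2 - B ^ 2)).mul_const p.2)).add_const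
      (A * B * p.2 ^ 2)).add (chx hg p)).deriv.trans ?_
    norm_num
    ring
  have hy : dy u = fun p => (A ^ 2 - B ^ 2) * p.1 + A * B * (2 * p.2)
      + A * deriv g (-B * p.1 + A * p.2) := by
    funext p
    simp only [dy, e]
    refine (((((hasDerivAt_id p.2).const_mul ((A ^ 2 - B ^ 2) * p.1)).const_add
      (-(A * B) * p.1 ^ 2)).add ((hasDerivAt_pow 2 p.2).const_mul (A * B))).add
      (chy hg p)).deriv.trans ?_
    norm_num
    ring
  refine ⟨?_, fun p => ?_⟩
  · rw [e]
    have := hg.comp (f := fun p : ℝ × ℝ => -B * p.1 + A * p.2) (by fun_prop)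
    exact ContDiff.add (by fun_prop) this
  have hxx : dx (dx u) p = -(2 * A * B) + B ^ 2 * deriv (deriv g) (-B * p.1 + A * p.2) := by
    rw [hx]
    refine (((((hasDerivAt_id p.1).const_mul 2).const_mul (-(A * B))).add_const
      ((A ^ 2 - B ^ 2) * p.2)).sub ((chx hg' p).const_mul B)).deriv.trans ?_
    ring
  have hxy : dy (dx u) p = A ^ 2 - B ^ 2 - A * B * deriv (deriv g) (-B * p.1 + A * p.2) := by
    rw [hx]
    refine ((((hasDerivAt_id p.2).const_mul (A ^ 2 - B ^ 2)).const_add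
      (-(A * B) * (2 * p.1))).sub ((chy hg' p).const_mul B)).deriv.trans ?_
    ring
  have hyy : dy (dy u) p = 2 * A * B + A ^ 2 * deriv (deriv g) (-B * p.1 + A * p.2) := by
    rw [hy]
    refine (((((hasDerivAt_id p.2).const_mul 2).const_mul (A * B)).const_add
      ((A ^ 2 - B ^ 2) * p.1)).add ((chy hg' p).const_mul A)).deriv.trans ?_
    ring
  -- `S` is a multiple of `(-B, A)`, so the equation reduces to the vanishing of the Hessian on `(A,
  -- B)`.
  have hP : dx u p - p.2 = -B * (2 * (A * p.1 + B * p.2)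
      + deriv g (-B * p.1 + A * p.2)) := by
    rw [hx]; linear_combination p.2 * hAB
  have hQ : dy u p + p.1 = A * (2 * (A * p.1 + B * p.2)
      + deriv g (-B * p.1 + A * p.2)) := by
    rw [hy]; linear_combination -p.1 * hAB
  unfold GraphEquationAt
  rw [hP, hQ, hxx, hxy, hyy]
  ring

/-! ### Characteristic curves of general type -/

lemma not_hasGeneralTypeLeaf (hu : IsEntireSmoothSolution u) : ¬ HasGeneralTypeLeaf u := by
  rintro ⟨s₀, s₁, c, a, b, α, c₁, c₂, hs, hc₂, H⟩
  have hchar : ∀ s ∈ Ioo s₀ s₁, HasDerivAt c (a s, b s) s ∧ tangential u (a s) (b s) (c s) = 0 ∧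
      s + c₁ ≠ 0 ∧ transverse u (a s) (b s) (c s) = ((s + c₁) ^ 2 + c₂) / (s + c₁) := by
    intro s hs
    obtain ⟨-, hab, hd, htan, hne, hα⟩ := H s hs
    have hd1 := (hasFDerivAt_fst (𝕜 := ℝ)).comp_hasDerivAt s hd
    have hd2 := (hasFDerivAt_fst (𝕜 := ℝ)).comp_hasDerivAt s
      ((hasFDerivAt_snd (𝕜 := ℝ)).comp_hasDerivAt s hd)
    have hd3 := (hasFDerivAt_snd (𝕜 := ℝ)).comp_hasDerivAt s
      ((hasFDerivAt_snd (𝕜 := ℝ)).comp_hasDerivAt s hd)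
    have hc : HasDerivAt c (a s, b s) s :=
      (hd1.prodMk hd2).congr_deriv (by simp [horizontal])
    have ht : tangential u (a s) (b s) (c s) = 0 := by
      have := (hasDerivAt_along hu.1 hc).unique hd3
      simp [horizontal, graphPoint] at this
      unfold tangential slopeX slopeY
      linear_combination this
    have hα1 : α s * transverse u (a s) (b s) (c s) = 1 := by
      simp [TangentToGraph, horizontal, graphPoint, reeb] at htan
      unfold transverse slopeX slopeY
      linear_combination -htan
    have hα0 : s + c₁ ≠ 0 := by
      intro e
      rw [hα, e] at hα1
      simp at hα1
    refine ⟨hc, ht, hα0, ?_⟩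
    rw [hα] at hα1
    field_simp at hα1 ⊢
    linear_combination hα1
  obtain ⟨s, hsm⟩ := nonempty_Ioo.2 hs
  obtain ⟨hc, ht, hs0, hD⟩ := hchar s hsm
  obtain ⟨-, hab, -, -, hne, -⟩ := H s hsm
  set E : ℝ → ℝ := fun s => ((s + c₁) ^ 2 + c₂) / (s + c₁) with hE
  have hD0 : transverse u (a s) (b s) (c s) ≠ 0 := by rw [hD]; exact div_ne_zero hne hs0
  -- Differentiating `|S|²` instead of `D` avoids derivatives of `a` and `b`, which are not assumed
  -- to exist; comparison with `E E'` yields `1 + v = E'`.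
  have hsq : (fun s => slopeX u (c s) ^ 2 + slopeY u (c s) ^ 2) =ᶠ[nhds s] fun s => E s ^ 2 := by
    filter_upwards [isOpen_Ioo.mem_nhds hsm] with r hr
    obtain ⟨-, ht, -, hD⟩ := hchar r hr
    obtain ⟨-, hab, -⟩ := H r hr
    rw [hE]
    simp only [← hD]
    have ht' : a r * slopeX u (c r) + b r * slopeY u (c r) = 0 := ht
    unfold transverse
    linear_combination (-slopeX u (c r) ^ 2 - slopeY u (c r) ^ 2) * hab
      + (a r * slopeX u (c r) + b r * slopeY u (c r)) * ht'
  have hlin : HasDerivAt (fun s : ℝ => s + c₁) 1 s := (hasDerivAt_id s).add_const c₁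
  have hEd : HasDerivAt E (1 - c₂ / (s + c₁) ^ 2) s := by
    refine (((hlin.fun_pow 2).add_const c₂).div hlin hs0).congr_deriv ?_
    norm_num
    field_simp
    ring
  have hder := (((hasDerivAt_slopeX hu.1 hc).fun_pow 2).add
    ((hasDerivAt_slopeY hu.1 hc).fun_pow 2)).unique ((hEd.fun_pow 2).congr_of_eventuallyEq hsq)
  have hX : slopeX u (c s) = -b s * E s := by
    rw [hE]
    simp only [← hD]
    unfold tangential at ht
    unfold transverse
    linear_combination a s * ht - slopeX u (c s) * hab
  have hY : slopeY u (c s) = a s * E s := by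
    rw [hE]
    simp only [← hD]
    unfold tangential at ht
    unfold transverse
    linear_combination b s * ht - slopeY u (c s) * hab
  have hE0 : E s ≠ 0 := by rw [hD] at hD0; exact hD0
  have hv : hessMixed u (a s) (b s) (c s) = -c₂ / (s + c₁) ^ 2 := by
    norm_num [hX, hY] at hder
    apply mul_left_cancel₀ hE0
    unfold hessMixed
    linear_combination hder / 2 - E s * hab
  rcases hessMixed_eq_zero_or_one hu hab ht hD0 with h | h
  · rw [hv, div_eq_zero_iff, neg_eq_zero] at h
    exact h.elim hc₂ (pow_ne_zero 2 hs0)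
  · rw [hv, div_eq_one_iff_eq (pow_ne_zero 2 hs0)] at h
    exact hne (by linarith)

end PMinimal

end

theorem mainTheorem10 :
    (∀ u : ℝ × ℝ → ℝ, PMinimal.IsEntireSmoothSolution u ↔
      PMinimal.IsAffineSolution u ∨ PMinimal.IsRuledSolution u) ∧
    (∀ u : ℝ × ℝ → ℝ, PMinimal.IsEntireSmoothSolution u → ¬ PMinimal.HasGeneralTypeLeaf u) := by
  refine ⟨fun u => ⟨fun hu => ?_, ?_⟩, fun u hu => PMinimal.not_hasGeneralTypeLeaf hu⟩
  · rcases PMinimal.hessDet_const hu with h | h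
    · exact Or.inl (PMinimal.isAffineSolution_of_hessDet hu h)
    · exact Or.inr (PMinimal.isRuledSolution_of_hessDet hu h)
  · rintro (h | h)
    · exact PMinimal.isEntireSmoothSolution_of_affine h
    · exact PMinimal.isEntireSmoothSolution_of_ruled h
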